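/- For a real $p_1\times p_2$ matrix $\mathbf X\neq 0$ with $p_1p_2>1$, define the Hoyer index $$h(\mathbf X)=\frac{\sqrt{p_1p_2}-\dfrac{\left|\sum_{i=1}^{p_1}\sum_{j=1}^{p_2}\mathbf X_{ij}\right|}{\|\mathbf X\|_F}}{\sqrt{p_1p_2}-1},$$ where $\|\cdot\|_F$ is the Frobenius norm. Let $(e_{ij})_{i,j\ge 1}$ be an infinite array of i.i.d. real random variables on a probability space, with mean zero and finite variance $\sigma^2>0$, and for $p_1,p_2\ge 1$ let $\mathbf e=\mathbf e^{(p_1,p_2)}=(e_{ij})_{1\le i\le p_1,\,1\le j\le p_2}$ be its upper left $p_1\times p_2$ corner. Then almost surely $\mathbf e\ne 0$ whenever $p_1p_2$ is large enough, and, as $p_1p_2\to\infty$, $$1-h(\mathbf e)=O_{a.s.}\left(\sqrt{\frac{\log\log (p_1p_2)}{p_1p_2}}\right);$$ that is, almost surely there are a finite (random) constant $C$ and a (random) $N$ such that $|1-h(\mathbf e)|\le C\sqrt{\log\log(p_1p_2)/(p_1p_2)}$ for all $p_1,p_2\ge1$ with $p_1p_2\ge N$. -/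

import Mathlib

open MeasureTheory ProbabilityTheory Filter Asymptotics

noncomputable section HoyerDefs

attribute [local instance] Matrix.frobeniusNormedAddCommGroup

/-- The Hoyer index of a real `p₁ × p₂` matrix; `‖X‖` is the Frobenius norm.
It is meaningful for `X ≠ 0` and `1 < p₁ * p₂`. -/
def hoyerIndex {p₁ p₂ : ℕ} (X : Matrix (Fin p₁) (Fin p₂) ℝ) : ℝ :=
  (√((p₁ : ℝ) * p₂) - |∑ i, ∑ j, X i j| / ‖X‖) * (√((p₁ : ℝ) * p₂) - 1)⁻¹

end HoyerDefs

/-- The `p₁ × p₂` random matrix cut out of the upper left corner of an infinite random array. -/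
def noiseMatrix {Ω : Type*} (e : ℕ → ℕ → Ω → ℝ) (p₁ p₂ : ℕ) (ω : Ω) :
    Matrix (Fin p₁) (Fin p₂) ℝ :=
  Matrix.of fun i j => e i j ω

/-- `X = O_{a.s.}(r)` along the filter `l`: for almost every `ω` there is a (possibly
`ω`-dependent) constant `C` with `|X p ω| ≤ C * |r p|` eventually along `l`. -/
def IsBigOAS {Ω α : Type*} [MeasurableSpace Ω] (μ : Measure Ω) (l : Filter α)
    (X : α → Ω → ℝ) (r : α → ℝ) : Prop :=
  ∀ᵐ ω ∂μ, (fun p => X p ω) =O[l] r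

/-- The filter `p₁ * p₂ → ∞` on pairs of sizes. -/
def sizeAtTop : Filter (ℕ × ℕ) :=
  Filter.comap (fun p : ℕ × ℕ => p.1 * p.2) Filter.atTop

/-! With `n = p₁p₂` and `r = |∑ e_ij| / ‖e‖_F` one has `1 - h = (r - 1) / (√n - 1)`, so the claim is
a self-normalized law of the iterated logarithm, `r = O(√(log log n))`, over all rectangles.

Group the sizes into dyadic blocks `(a, b)`, put `L = log (a + b + 2)`, which is `O(log log n)`, and
truncate at the level `B` with `B²L = 2^(a+b)`. The sum splits into three pieces. The centred
truncated part is `O(BL)` by Chernoff's bound, for all rectangles of the block at once by Etemadi's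
inequality applied in each direction. The truncation bias is at most `n v / B = O(BL)`. Only `O(L)`
entries exceed `B`, so by Cauchy–Schwarz they contribute `O(√L) ‖e‖_F`; self-normalization thus
absorbs the large entries, and two moments suffice. Finally `‖e‖_F²` is at least a multiple of
`2^(a+b) = B²L`, because a positive fraction of the entries is bounded away from zero, so `BL = O(√L
‖e‖_F)`.

The failure probabilities are summable over pairs `(a, b)`, and Borel–Cantelli concludes. The
carrying lemmas are `etemadi_maximal_inequality_rectangles`, `abs_sum_le_of_cutoff` and
`measure_badEvent_le`. -/

/-! ### Maximal inequalities -/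

/-- Etemadi's maximal inequality for vector-valued partial sums, with respect to the sup norm. -/
theorem etemadi_maximal_inequality {Ω κ : Type*} [MeasurableSpace Ω] {μ : Measure Ω}
    [IsProbabilityMeasure μ] [Fintype κ] (S : ℕ → Ω → κ → ℝ) (hS : ∀ k, Measurable (S k)) (n : ℕ)
    (hind : ∀ k ≤ n, IndepFun (fun ω (x : Set.Iic k × κ) => S x.1 ω x.2)
      (fun ω x => S n ω x - S k ω x) μ)
    (t : ℝ) (δ : ENNReal) (hδ : ∀ k ≤ n, μ {ω | t ≤ ‖S k ω‖} ≤ δ) :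
    μ {ω | ∃ k ≤ n, 3 * t ≤ ‖S k ω‖} ≤ 3 * δ := by
  classical
  -- `A k`: the level `3t` is first reached at time `k`. If then `‖S n‖ < t`, the remaining
  -- increment has norm at least `2t`, which is `D k`.
  let A : ℕ → Set Ω := fun k => {ω | 3 * t ≤ ‖S k ω‖ ∧ ∀ i < k, ‖S i ω‖ < 3 * t}
  let D : ℕ → Set Ω := fun k => {ω | 2 * t ≤ ‖fun x => S n ω x - S k ω x‖}
  have hA : ∀ k, MeasurableSet (A k) := fun k => by
    refine MeasurableSet.inter (measurableSet_le measurable_const (hS k).norm) ?_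
    have : {ω | ∀ i < k, ‖S i ω‖ < 3 * t} = ⋂ i, ⋂ (_ : i < k), {ω | ‖S i ω‖ < 3 * t} := by
      ext; simp
    change MeasurableSet {ω | ∀ i < k, ‖S i ω‖ < 3 * t}
    rw [this]
    exact MeasurableSet.iInter fun i => MeasurableSet.iInter fun _ =>
      measurableSet_lt (hS i).norm measurable_const
  have hdisj : Pairwise (Function.onFun Disjoint A) := by
    have key : ∀ i j, i < j → Disjoint (A i) (A j) := fun i j hij =>
      Set.disjoint_left.2 fun ω hi hj => absurd hi.1 (not_le.2 (hj.2 i hij))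
    intro i j hij
    rcases lt_or_gt_of_ne hij with h | h
    · exact key i j h
    · exact (key j i h).symm
  have hD : ∀ k ≤ n, μ (D k) ≤ 2 * δ := fun k hk => by
    calc μ (D k) ≤ μ ({ω | t ≤ ‖S n ω‖} ∪ {ω | t ≤ ‖S k ω‖}) := by
          refine measure_mono fun ω hω => ?_
          by_contra hcon
          simp only [Set.mem_union, Set.mem_ofPred_eq, not_or, not_le] at hcon
          have h1 : ‖S n ω - S k ω‖ ≤ ‖S n ω‖ + ‖S k ω‖ := norm_sub_le _ _
          have h2 : 2 * t ≤ ‖S n ω - S k ω‖ := hω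
          linarith
      _ ≤ δ + δ := (measure_union_le _ _).trans (add_le_add (hδ n le_rfl) (hδ k hk))
      _ = 2 * δ := (two_mul δ).symm
  have hAD : ∀ k ≤ n, μ (A k ∩ D k) = μ (A k) * μ (D k) := fun k hk => by
    -- `A k` depends only on the sums up to time `k`; writing it as a preimage under them makes it
    -- independent of the increment in `D k`.
    let past : Set (Set.Iic k × κ → ℝ) := {y | 3 * t ≤ ‖fun x => y (⟨k, Set.self_mem_Iic⟩, x)‖ ∧
      ∀ i : Set.Iio k, ‖fun x => y (⟨i.1, Set.Iio_subset_Iic_self i.2⟩, x)‖ < 3 * t}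
    have hpast : MeasurableSet past := by
      have hn : ∀ i : Set.Iic k, Measurable fun y : Set.Iic k × κ → ℝ => ‖fun x => y (i, x)‖ :=
        fun i => by fun_prop
      refine MeasurableSet.inter (measurableSet_le measurable_const (hn _)) ?_
      have : {y : Set.Iic k × κ → ℝ | ∀ i : Set.Iio k,
          ‖fun x => y (⟨i.1, Set.Iio_subset_Iic_self i.2⟩, x)‖ < 3 * t} = ⋂ i : Set.Iio k,
          {y | ‖fun x => y (⟨i.1, Set.Iio_subset_Iic_self i.2⟩, x)‖ < 3 * t} := by ext; simp
      change MeasurableSet {y : Set.Iic k × κ → ℝ | ∀ i : Set.Iio k,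
          ‖fun x => y (⟨i.1, Set.Iio_subset_Iic_self i.2⟩, x)‖ < 3 * t}
      rw [this]
      exact MeasurableSet.iInter fun i => measurableSet_lt (hn _) measurable_const
    have h := (hind k hk).measure_inter_preimage_eq_mul past {y | 2 * t ≤ ‖y‖} hpast
      (measurableSet_le measurable_const measurable_norm)
    have e1 : (fun ω (x : Set.Iic k × κ) => S x.1 ω x.2) ⁻¹' past = A k := by
      ext ω
      exact and_congr Iff.rfl ⟨fun h i hi => h ⟨i, hi⟩, fun h i => h i.1 i.2⟩
    rw [e1] at h
    exact h
  have hcover : {ω | ∃ k ≤ n, 3 * t ≤ ‖S k ω‖} ⊆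
      {ω | t ≤ ‖S n ω‖} ∪ ⋃ k ∈ Finset.range (n + 1), A k ∩ D k := by
    intro ω hω
    have hex : ∃ k, 3 * t ≤ ‖S k ω‖ := let ⟨k, _, h⟩ := hω; ⟨k, h⟩
    obtain ⟨k₀, hk₀, hk₀'⟩ := hω
    have hle : Nat.find hex ≤ n := (Nat.find_min' hex hk₀').trans hk₀
    by_cases hn : t ≤ ‖S n ω‖
    · exact Or.inl hn
    refine Or.inr (Set.mem_iUnion₂.2 ⟨Nat.find hex, Finset.mem_range.2 (by omega),
      ⟨Nat.find_spec hex, fun i hi => not_le.1 (Nat.find_min hex hi)⟩, ?_⟩)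
    have h1 := Nat.find_spec hex
    have h2 : ‖S (Nat.find hex) ω‖ - ‖S n ω‖ ≤ ‖S n ω - S (Nat.find hex) ω‖ := by
      rw [norm_sub_rev]; exact norm_sub_norm_le _ _
    change 2 * t ≤ ‖S n ω - S (Nat.find hex) ω‖
    linarith
  calc μ {ω | ∃ k ≤ n, 3 * t ≤ ‖S k ω‖}
      ≤ μ {ω | t ≤ ‖S n ω‖} + ∑ k ∈ Finset.range (n + 1), μ (A k ∩ D k) :=
        (measure_mono hcover).trans ((measure_union_le _ _).trans
          (add_le_add le_rfl (measure_biUnion_finset_le _ _)))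
    _ ≤ δ + ∑ k ∈ Finset.range (n + 1), μ (A k) * (2 * δ) := by
        refine add_le_add (hδ n le_rfl) (Finset.sum_le_sum fun k hk => ?_)
        have hk' : k ≤ n := Nat.lt_succ_iff.1 (Finset.mem_range.1 hk)
        rw [hAD k hk']
        gcongr
        exact hD k hk'
    _ = δ + μ (⋃ k ∈ Finset.range (n + 1), A k) * (2 * δ) := by
        rw [← Finset.sum_mul, measure_biUnion_finset (fun i _ j _ hij => hdisj hij)
          (fun k _ => hA k)]
    _ ≤ δ + 1 * (2 * δ) := by gcongr; exact prob_le_one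
    _ = 3 * δ := by ring

/-- Partial sums of an independent family over index sets inside two disjoint finite sets are
independent. -/
theorem indepFun_finsetSum_families {Ω ι : Type*} {α β : Type} [MeasurableSpace Ω] {μ : Measure Ω}
    {Y : ι → Ω → ℝ} (hY : iIndepFun Y μ) (hm : ∀ i, Measurable (Y i))
    {T U : Finset ι} (hTU : Disjoint T U) (A : α → Finset ι) (B : β → Finset ι)
    (hA : ∀ a, A a ⊆ T) (hB : ∀ b, B b ⊆ U) :
    IndepFun (fun ω a => ∑ i ∈ A a, Y i ω) (fun ω b => ∑ i ∈ B b, Y i ω) μ := by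
  classical
  -- Both families factor through the restriction of `Y` to a finite set; the default `0` is never
  -- reached, since `C c ⊆ V`.
  have key : ∀ {γ : Type} (V : Finset ι) (C : γ → Finset ι), (∀ c, C c ⊆ V) →
      (fun (ω : Ω) c => ∑ i ∈ C c, Y i ω) =
        (fun (y : V → ℝ) c => ∑ i ∈ C c, if h : i ∈ V then y ⟨i, h⟩ else 0) ∘
          (fun ω (i : V) => Y i ω) := by
    intro γ V C hC
    ext ω c
    refine Finset.sum_congr rfl fun i hi => ?_
    simp [hC c hi]
  have meas : ∀ {γ : Type} (V : Finset ι) (C : γ → Finset ι),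
      Measurable (fun (y : V → ℝ) c => ∑ i ∈ C c, if h : i ∈ V then y ⟨i, h⟩ else 0) := by
    intro γ V C
    refine measurable_pi_lambda _ fun c => Finset.measurable_sum _ fun i _ => ?_
    split_ifs with h
    · exact measurable_pi_apply _
    · exact measurable_const
  have h := (hY.indepFun_finset T U hTU hm).comp (meas T A) (meas U B)
  rwa [← key T A hA, ← key U B hB] at h

/-- Etemadi's maximal inequality for the sums of an independent array over all rectangles
contained in a given one. -/
theorem etemadi_maximal_inequality_rectangles {Ω : Type*} [MeasurableSpace Ω] {μ : Measure Ω}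
    [IsProbabilityMeasure μ] {Y : ℕ × ℕ → Ω → ℝ} (hY : iIndepFun Y μ)
    (hm : ∀ i, Measurable (Y i)) (P Q : ℕ) {t : ℝ} (ht : 0 < t) (δ : ENNReal)
    (hδ : ∀ p ≤ P, ∀ q ≤ Q,
      μ {ω | t ≤ |∑ i ∈ Finset.range p ×ˢ Finset.range q, Y i ω|} ≤ δ) :
    μ {ω | ∃ p ≤ P, ∃ q ≤ Q,
      9 * t ≤ |∑ i ∈ Finset.range p ×ˢ Finset.range q, Y i ω|} ≤ 9 * δ := by
  classical
  have hrow : ∀ p ≤ P, μ {ω | ∃ q ≤ Q,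
      3 * t ≤ |∑ i ∈ Finset.range p ×ˢ Finset.range q, Y i ω|} ≤ 3 * δ := by
    intro p hp
    have h := etemadi_maximal_inequality (μ := μ) (κ := Unit)
      (fun q ω _ => ∑ i ∈ Finset.range p ×ˢ Finset.range q, Y i ω)
      (fun q => measurable_pi_lambda _ fun _ => Finset.measurable_sum _ fun i _ => hm i)
      Q (fun k hk => ?_) t δ (fun q hq => by simpa using hδ p hp q hq)
    · simpa using h
    · have hsub : Finset.range p ×ˢ Finset.range k ⊆ Finset.range p ×ˢ Finset.range Q :=
        Finset.product_subset_product_right (Finset.range_mono hk)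
      have := indepFun_finsetSum_families hY hm
        (T := Finset.range p ×ˢ Finset.range k)
        (U := (Finset.range p ×ˢ Finset.range Q) \ (Finset.range p ×ˢ Finset.range k))
        Finset.disjoint_sdiff
        (fun x : Set.Iic k × Unit => Finset.range p ×ˢ Finset.range x.1)
        (fun _ : Unit => (Finset.range p ×ˢ Finset.range Q) \ (Finset.range p ×ˢ Finset.range k))
        (fun x => Finset.product_subset_product_right (Finset.range_mono x.1.2))
        (fun _ => subset_rfl)
      convert this using 3
      rw [Finset.sum_sdiff_eq_sub hsub]
  have hnorm : ∀ (p : ℕ) (ω : Ω) {r : ℝ}, 0 < r →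
      (r ≤ ‖fun q : Fin (Q + 1) => ∑ i ∈ Finset.range p ×ˢ Finset.range q, Y i ω‖ ↔
        ∃ q ≤ Q, r ≤ |∑ i ∈ Finset.range p ×ˢ Finset.range q, Y i ω|) := by
    intro p ω r hr
    rw [← not_iff_not, not_le, pi_norm_lt_iff hr]
    simp only [Real.norm_eq_abs, not_exists, not_and, not_le]
    exact ⟨fun h q hq => h ⟨q, by omega⟩, fun h q => h q (by omega)⟩
  -- The sup norm over `q` absorbs the maximum in the second direction, so the vector inequality in
  -- `p` uses the bound `hrow` as its hypothesis; hence `9 = 3 * 3`.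
  have h := etemadi_maximal_inequality (μ := μ) (κ := Fin (Q + 1))
    (fun p ω q => ∑ i ∈ Finset.range p ×ˢ Finset.range q, Y i ω)
    (fun q => measurable_pi_lambda _ fun _ => Finset.measurable_sum _ fun i _ => hm i)
    P (fun k hk => ?_) (3 * t) (3 * δ) (fun p hp => by
      simp only [hnorm p _ (show 0 < 3 * t by linarith)]
      exact hrow p hp)
  · simp only [hnorm _ _ (show 0 < 3 * (3 * t) by linarith)] at h
    rwa [← mul_assoc, ← mul_assoc, show (3 : ℝ) * 3 = 9 by norm_num,
      show (3 : ENNReal) * 3 = 9 by norm_num] at h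
  · have := indepFun_finsetSum_families hY hm
      (T := Finset.range k ×ˢ Finset.range (Q + 1))
      (U := (Finset.range P \ Finset.range k) ×ˢ Finset.range (Q + 1))
      (Finset.disjoint_product.2 (Or.inl Finset.disjoint_sdiff))
      (fun x : Set.Iic k × Fin (Q + 1) => Finset.range x.1 ×ˢ Finset.range x.2)
      (fun q : Fin (Q + 1) => (Finset.range P \ Finset.range k) ×ˢ Finset.range q)
      (fun x => Finset.product_subset_product (Finset.range_mono x.1.2)
        (Finset.range_mono (by omega)))
      (fun q => Finset.product_subset_product_right (Finset.range_mono (by omega)))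
    convert this using 3 with ω q
    rw [Finset.sum_product, Finset.sum_product, Finset.sum_product,
      Finset.sum_sdiff_eq_sub (Finset.range_mono hk)]

/-! ### Truncation and exponential estimates -/

/-- Chernoff's bound for a sum of bounded independent variables with uniformly bounded moment
generating functions. -/
theorem measure_le_finsetSum_le_exp {Ω ι : Type*} [MeasurableSpace Ω] {μ : Measure Ω}
    [IsProbabilityMeasure μ] {Z : ι → Ω → ℝ} (hZ : iIndepFun Z μ) (hm : ∀ i, Measurable (Z i))
    {M a : ℝ} (hM : ∀ i ω, |Z i ω| ≤ M) (ha : ∀ i, mgf (Z i) μ 1 ≤ Real.exp a)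
    (s : Finset ι) (t : ℝ) :
    μ {ω | t ≤ ∑ i ∈ s, Z i ω} ≤ ENNReal.ofReal (Real.exp (s.card * a - t)) := by
  have hint : ∀ i ∈ s, Integrable (fun ω => Real.exp (1 * Z i ω)) μ := fun i _ => by
    refine Integrable.of_bound (by fun_prop) (Real.exp M) (ae_of_all _ fun ω => ?_)
    rw [Real.norm_eq_abs, Real.abs_exp, one_mul]
    exact Real.exp_le_exp.2 ((le_abs_self _).trans (hM i ω))
  have h := measure_ge_le_exp_mul_mgf (μ := μ) (X := ∑ i ∈ s, Z i) (t := 1) t zero_le_one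
    (hZ.integrable_exp_mul_sum hm hint)
  rw [hZ.mgf_sum hm] at h
  simp only [Finset.sum_apply] at h
  refine (ENNReal.le_ofReal_iff_toReal_le (measure_ne_top _ _) (Real.exp_pos _).le).2 (h.trans ?_)
  calc Real.exp (-1 * t) * ∏ i ∈ s, mgf (Z i) μ 1
      ≤ Real.exp (-1 * t) * ∏ _i ∈ s, Real.exp a := by
        gcongr with i hi
        · exact fun i _ => mgf_nonneg
        · exact ha i
    _ = Real.exp (s.card * a - t) := by
        rw [Finset.prod_const, ← Real.exp_nat_mul, ← Real.exp_add]
        ring_nf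

/-- The value `x` if `|x| ≤ B`, and `0` otherwise. -/
noncomputable def cutoff (B x : ℝ) : ℝ := if |x| ≤ B then x else 0

theorem measurable_cutoff (B : ℝ) : Measurable (cutoff B) :=
  Measurable.ite (measurableSet_le (by fun_prop) measurable_const) measurable_id measurable_const

theorem abs_cutoff_le {B : ℝ} (hB : 0 ≤ B) (x : ℝ) : |cutoff B x| ≤ B := by
  unfold cutoff
  split_ifs with h
  · exact h
  · simpa using hB

theorem cutoff_sq_le (B x : ℝ) : cutoff B x ^ 2 ≤ x ^ 2 := by
  unfold cutoff
  split_ifs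
  · exact le_rfl
  · simpa using sq_nonneg x

/-- The indicator of `B < |x|`. -/
noncomputable def exceed (B x : ℝ) : ℝ := if B < |x| then 1 else 0

theorem measurable_exceed (B : ℝ) : Measurable (exceed B) :=
  Measurable.ite (measurableSet_lt measurable_const (by fun_prop)) measurable_const measurable_const

theorem exceed_nonneg (B x : ℝ) : 0 ≤ exceed B x := by
  unfold exceed; split_ifs <;> norm_num

theorem abs_exceed_le (B x : ℝ) : |exceed B x| ≤ 1 := by
  unfold exceed; split_ifs <;> simp

theorem exceed_sq (B x : ℝ) : exceed B x ^ 2 = exceed B x := by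
  unfold exceed; split_ifs <;> simp

theorem cutoff_add_exceed_mul (B x : ℝ) : cutoff B x + exceed B x * x = x := by
  unfold cutoff exceed
  by_cases h : |x| ≤ B
  · simp [h, not_lt.2 h]
  · simp [h, not_le.1 h]

theorem exceed_le_sq_div {B : ℝ} (hB : 0 < B) (x : ℝ) : exceed B x ≤ x ^ 2 / B ^ 2 := by
  unfold exceed
  split_ifs with h
  · rw [le_div_iff₀ (by positivity), one_mul, ← sq_abs x]
    gcongr
  · positivity

theorem exceed_mul_abs_le {B : ℝ} (hB : 0 < B) (x : ℝ) : exceed B x * |x| ≤ x ^ 2 / B := by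
  unfold exceed
  split_ifs with h
  · rw [le_div_iff₀ hB, ← sq_abs x]
    nlinarith [abs_nonneg x]
  · simp only [zero_mul]; positivity

section Estimates

variable {Ω : Type*} [MeasurableSpace Ω] {μ : Measure Ω} [IsProbabilityMeasure μ]

/-- A centred variable with values in an interval of small length has a sub-Gaussian moment
generating function controlled by the variance. -/
theorem mgf_mul_sub_integral_le {U : Ω → ℝ} (hU : Measurable U) {B v l : ℝ}
    (hUB : ∀ ω, |U ω| ≤ B) (hv : ∫ ω, U ω ^ 2 ∂μ ≤ v) (hl : |l| * (2 * B) ≤ 1) :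
    mgf (fun ω => l * (U ω - ∫ ω, U ω ∂μ)) μ 1 ≤ Real.exp (l ^ 2 * v) := by
  have hint : Integrable U μ := Integrable.of_bound hU.aestronglyMeasurable B (ae_of_all _ hUB)
  have hint2 : Integrable (fun ω => U ω ^ 2) μ :=
    Integrable.of_bound (by fun_prop) (B ^ 2) (ae_of_all _ fun ω => by
      rw [Real.norm_eq_abs, abs_pow]; gcongr; exact hUB ω)
  set m := ∫ ω, U ω ∂μ with hm
  have hmB : |m| ≤ B := by
    have := norm_integral_le_of_norm_le_const (μ := μ) (f := U) (C := B) (ae_of_all _ hUB)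
    simpa using this
  have hZ : ∀ ω, |l * (U ω - m)| ≤ 1 := fun ω => by
    rw [abs_mul]
    refine le_trans ?_ hl
    gcongr
    linarith [abs_sub (U ω) m, hUB ω]
  -- `exp z ≤ 1 + z + z²` for `|z| ≤ 1`, expanded as a polynomial in `U` so that it can be
  -- integrated term by term.
  have hpt : ∀ ω, Real.exp (1 * (l * (U ω - m))) ≤
      (1 - l * m + l ^ 2 * m ^ 2) + ((l - 2 * l ^ 2 * m) * U ω + l ^ 2 * U ω ^ 2) := fun ω => by
    have := (abs_le.1 (Real.abs_exp_sub_one_sub_id_le (hZ ω))).2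
    rw [one_mul]
    nlinarith
  unfold mgf
  calc ∫ ω, Real.exp (1 * (l * (U ω - m))) ∂μ
      ≤ ∫ ω, ((1 - l * m + l ^ 2 * m ^ 2) + ((l - 2 * l ^ 2 * m) * U ω + l ^ 2 * U ω ^ 2)) ∂μ := by
        refine integral_mono_of_nonneg (ae_of_all _ fun ω => (Real.exp_pos _).le) ?_
          (ae_of_all _ hpt)
        exact (integrable_const _).add ((hint.const_mul _).add (hint2.const_mul _))
    _ = 1 + l ^ 2 * (∫ ω, U ω ^ 2 ∂μ - m ^ 2) := by
        have hs : Integrable (fun ω => (l - 2 * l ^ 2 * m) * U ω + l ^ 2 * U ω ^ 2) μ :=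
          (hint.const_mul _).add (hint2.const_mul _)
        rw [integral_add (integrable_const _) hs, integral_add (hint.const_mul _) (hint2.const_mul _), integral_const_mul,
          integral_const_mul, ← hm]
        simp
        ring
    _ ≤ 1 + l ^ 2 * v := by
        gcongr
        nlinarith [sq_nonneg m]
    _ ≤ Real.exp (l ^ 2 * v) := by linarith [Real.add_one_le_exp (l ^ 2 * v)]

variable {ι : Type*} {X : ι → Ω → ℝ} {v : ℝ}

/-- Concentration of the sum of the centred truncated variables. -/
theorem measure_abs_sum_cutoff_ge (hX : iIndepFun X μ) (hm : ∀ i, Measurable (X i))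
    (hint : ∀ i, Integrable (fun ω => X i ω ^ 2) μ) (hv : ∀ i, ∫ ω, X i ω ^ 2 ∂μ ≤ v)
    {B L C : ℝ} (hB : 0 < B) (hv0 : 0 ≤ v) (s : Finset ι) (hs : (s.card : ℝ) ≤ 4 * B ^ 2 * L) :
    μ {ω | C * B * L ≤ |∑ i ∈ s, (cutoff B (X i ω) - ∫ ω, cutoff B (X i ω) ∂μ)|} ≤
      2 * ENNReal.ofReal (Real.exp ((v - C / 2) * L)) := by
  -- `l = ±1 / (2B)` is the largest tilt allowed by `mgf_mul_sub_integral_le`; it turns the variance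
  -- term into at most `vL` and the threshold `CBL` into `CL / 2`.
  have main : ∀ l : ℝ, |l| * (2 * B) = 1 →
      μ {ω | C / 2 * L ≤ ∑ i ∈ s, l * (cutoff B (X i ω) - ∫ ω, cutoff B (X i ω) ∂μ)} ≤
        ENNReal.ofReal (Real.exp ((v - C / 2) * L)) := by
    intro l hl
    have hl2 : l ^ 2 * (4 * B ^ 2) = 1 := by
      have := congrArg (· ^ 2) hl
      simp only [mul_pow, sq_abs] at this
      linarith
    have hmeas : ∀ i, Measurable fun x : ℝ => l * (cutoff B x - ∫ ω, cutoff B (X i ω) ∂μ) :=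
      fun i => ((measurable_cutoff B).sub_const _).const_mul _
    have hbd : ∀ i, |∫ ω, cutoff B (X i ω) ∂μ| ≤ B := fun i => by
      have := norm_integral_le_of_norm_le_const (μ := μ)
        (f := fun ω => cutoff B (X i ω)) (C := B) (ae_of_all _ fun ω => abs_cutoff_le hB.le (X i ω))
      simpa using this
    refine (measure_le_finsetSum_le_exp (M := |l| * (2 * B)) (a := l ^ 2 * v)
      (hX.comp _ hmeas) (fun i => (hmeas i).comp (hm i)) (fun i ω => ?_) (fun i => ?_) s _).trans ?_
    · simp only [Function.comp]
      rw [abs_mul]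
      gcongr
      linarith [abs_sub (cutoff B (X i ω)) (∫ ω, cutoff B (X i ω) ∂μ), hbd i,
        abs_cutoff_le hB.le (X i ω)]
    · refine mgf_mul_sub_integral_le ((measurable_cutoff B).comp (hm i))
        (fun ω => abs_cutoff_le hB.le _) ((integral_mono_of_nonneg (ae_of_all _ fun ω => sq_nonneg _)
          (hint i) (ae_of_all _ fun ω => cutoff_sq_le _ _)).trans (hv i)) hl.le
    · refine ENNReal.ofReal_le_ofReal (Real.exp_le_exp.2 ?_)
      have : (s.card : ℝ) * (l ^ 2 * v) ≤ 4 * B ^ 2 * L * (l ^ 2 * v) := by gcongr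
      have e : 4 * B ^ 2 * L * (l ^ 2 * v) = l ^ 2 * (4 * B ^ 2) * (L * v) := by ring
      rw [e, hl2] at this
      linarith
  have hB' : |1 / (2 * B)| * (2 * B) = 1 := by
    rw [abs_of_pos (by positivity)]; field_simp
  have h1 := main (1 / (2 * B)) hB'
  have h2 := main (-(1 / (2 * B))) (by rw [abs_neg]; exact hB')
  calc _ ≤ μ ({ω | C / 2 * L ≤ ∑ i ∈ s, 1 / (2 * B) *
          (cutoff B (X i ω) - ∫ ω, cutoff B (X i ω) ∂μ)} ∪
        {ω | C / 2 * L ≤ ∑ i ∈ s, -(1 / (2 * B)) *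
          (cutoff B (X i ω) - ∫ ω, cutoff B (X i ω) ∂μ)}) := by
        refine measure_mono fun ω hω => ?_
        simp only [Set.mem_union, Set.mem_ofPred_eq, ← Finset.mul_sum] at hω ⊢
        have e : C / 2 * L = 1 / (2 * B) * (C * B * L) := by field_simp
        rw [e, neg_mul_comm]
        have hp : 0 ≤ 1 / (2 * B) := by positivity
        rcases le_abs.1 hω with h | h
        · exact Or.inl (mul_le_mul_of_nonneg_left h hp)
        · exact Or.inr (mul_le_mul_of_nonneg_left h hp)
    _ ≤ _ := (measure_union_le _ _).trans ((add_le_add h1 h2).trans (two_mul _).symm.le)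

/-- The number of large variables is small with high probability. -/
theorem measure_sum_exceed_ge (hX : iIndepFun X μ) (hm : ∀ i, Measurable (X i))
    (hint : ∀ i, Integrable (fun ω => X i ω ^ 2) μ) (hv : ∀ i, ∫ ω, X i ω ^ 2 ∂μ ≤ v)
    {B L K : ℝ} (hB : 0 < B) (hv0 : 0 ≤ v) (s : Finset ι) (hs : (s.card : ℝ) ≤ 4 * B ^ 2 * L) :
    μ {ω | K * L ≤ ∑ i ∈ s, exceed B (X i ω)} ≤
      ENNReal.ofReal (Real.exp ((8 * v - K) * L)) := by
  refine (measure_le_finsetSum_le_exp (M := 1) (a := 2 * v / B ^ 2)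
      (hX.comp _ fun _ => measurable_exceed B) (fun i => (measurable_exceed B).comp (hm i))
      (fun i ω => abs_exceed_le _ _) (fun i => ?_) s _).trans ?_
  · unfold mgf
    calc ∫ ω, Real.exp (1 * exceed B (X i ω)) ∂μ
        ≤ ∫ ω, (1 + 2 / B ^ 2 * X i ω ^ 2) ∂μ := by
          refine integral_mono_of_nonneg (ae_of_all _ fun ω => (Real.exp_pos _).le)
            ((integrable_const _).add ((hint i).const_mul _)) (ae_of_all _ fun ω => ?_)
          have h1 := exceed_le_sq_div hB (X i ω)
          have h2 : Real.exp (1 * exceed B (X i ω)) ≤ 1 + 2 * exceed B (X i ω) := by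
            unfold exceed
            split_ifs
            · norm_num
              linarith [Real.exp_one_lt_d9]
            · simp
          calc _ ≤ _ := h2
            _ ≤ 1 + 2 * (X i ω ^ 2 / B ^ 2) := by gcongr
            _ = _ := by ring
      _ = 1 + 2 / B ^ 2 * ∫ ω, X i ω ^ 2 ∂μ := by
          rw [integral_add (integrable_const _) ((hint i).const_mul _), integral_const_mul]
          simp
      _ ≤ 1 + 2 / B ^ 2 * v := by gcongr; exact hv i
      _ ≤ Real.exp (2 * v / B ^ 2) := by
          have := Real.add_one_le_exp (2 * v / B ^ 2)
          have e : 2 / B ^ 2 * v = 2 * v / B ^ 2 := by ring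
          linarith
  · refine ENNReal.ofReal_le_ofReal (Real.exp_le_exp.2 ?_)
    have : (s.card : ℝ) * (2 * v / B ^ 2) ≤ 4 * B ^ 2 * L * (2 * v / B ^ 2) := by gcongr
    have e : 4 * B ^ 2 * L * (2 * v / B ^ 2) = 8 * v * L := by field_simp; ring
    linarith

/-- The number of variables that are bounded away from `0` grows linearly with high probability. -/
theorem measure_sum_exceed_le (hX : iIndepFun X μ) (hm : ∀ i, Measurable (X i)) {d q : ℝ}
    (hq : ∀ i, q ≤ ∫ ω, exceed d (X i ω) ∂μ) (s : Finset ι) :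
    μ {ω | ∑ i ∈ s, exceed d (X i ω) ≤ s.card * (q / 4)} ≤
      ENNReal.ofReal (Real.exp (-(s.card * (q / 4)))) := by
  -- Lower tail through the negated indicators: `exp (-1) ≤ 1/2` makes each generating function at
  -- most `1 - q/2 ≤ exp (-q/2)`, and the threshold `q/4` uses up half of this exponent.
  have h := measure_le_finsetSum_le_exp (μ := μ) (M := 1) (a := -(q / 2))
      (hX.comp (fun _ x => -exceed d x) fun _ => (measurable_exceed d).neg)
      (fun i => (measurable_exceed d).neg.comp (hm i))
      (fun i ω => by simpa using abs_exceed_le d (X i ω)) (fun i => ?_) s (-(s.card * (q / 4)))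
  · simp only [Function.comp, Finset.sum_neg_distrib, neg_le_neg_iff] at h
    convert h using 3
    ring
  · unfold mgf
    have hi : Integrable (fun ω => exceed d (X i ω)) μ :=
      Integrable.of_bound ((measurable_exceed d).comp (hm i)).aestronglyMeasurable 1
        (ae_of_all _ fun ω => abs_exceed_le _ _)
    calc ∫ ω, Real.exp (1 * -exceed d (X i ω)) ∂μ
        ≤ ∫ ω, (1 + -(1 / 2) * exceed d (X i ω)) ∂μ := by
          refine integral_mono_of_nonneg (ae_of_all _ fun ω => (Real.exp_pos _).le)
            ((integrable_const _).add (hi.const_mul _)) (ae_of_all _ fun ω => ?_)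
          simp only
          unfold exceed
          split_ifs
          · have h1 : Real.exp (-1) * Real.exp 1 = 1 := by
              rw [← Real.exp_add]; norm_num
            have h2 : Real.exp (-1) ≤ 1 / 2 := by
              nlinarith [Real.exp_one_gt_d9, Real.exp_pos (-1)]
            norm_num
            linarith
          · simp
      _ = 1 - 1 / 2 * ∫ ω, exceed d (X i ω) ∂μ := by
          rw [integral_add (integrable_const _) (hi.const_mul _), integral_const_mul]
          simp
          ring
      _ ≤ -(q / 2) + 1 := by linarith [hq i]
      _ ≤ Real.exp (-(q / 2)) := Real.add_one_le_exp _

/-- Truncation changes the mean of a centred variable by little. -/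
theorem abs_integral_cutoff_le {W : Ω → ℝ} (hW : Measurable W) (hi : Integrable W μ)
    (hi2 : Integrable (fun ω => W ω ^ 2) μ) (h0 : ∫ ω, W ω ∂μ = 0)
    (hWv : ∫ ω, W ω ^ 2 ∂μ ≤ v) {B : ℝ} (hB : 0 < B) :
    |∫ ω, cutoff B (W ω) ∂μ| ≤ v / B := by
  have hc : Integrable (fun ω => cutoff B (W ω)) μ :=
    Integrable.of_bound ((measurable_cutoff B).comp hW).aestronglyMeasurable B
      (ae_of_all _ fun ω => abs_cutoff_le hB.le _)
  -- Since `W` is centred, the truncated mean is minus the mean of the discarded part.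
  have e : ∫ ω, cutoff B (W ω) ∂μ = ∫ ω, -(exceed B (W ω) * W ω) ∂μ := by
    have : ∀ ω, -(exceed B (W ω) * W ω) = cutoff B (W ω) - W ω := fun ω => by
      linarith [cutoff_add_exceed_mul B (W ω)]
    simp_rw [this]
    rw [integral_sub hc hi, h0, sub_zero]
  rw [e]
  calc |∫ ω, -(exceed B (W ω) * W ω) ∂μ| ≤ ∫ ω, |-(exceed B (W ω) * W ω)| ∂μ :=
        abs_integral_le_integral_abs
    _ ≤ ∫ ω, W ω ^ 2 / B ∂μ := by
        refine integral_mono_of_nonneg (ae_of_all _ fun ω => abs_nonneg _) (hi2.div_const _)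
          (ae_of_all _ fun ω => ?_)
        simp only [abs_neg, abs_mul, abs_of_nonneg (exceed_nonneg _ _)]
        exact exceed_mul_abs_le hB _
    _ = (∫ ω, W ω ^ 2 ∂μ) / B := integral_div _ _
    _ ≤ v / B := by gcongr

end Estimates

/-! ### Deterministic self-normalized bound -/

/-- The rectangle `{0, …, p - 1} × {0, …, q - 1}`. -/
def rect (p : ℕ × ℕ) : Finset (ℕ × ℕ) := Finset.range p.1 ×ˢ Finset.range p.2

theorem card_rect (p : ℕ × ℕ) : (rect p).card = p.1 * p.2 := by
  simp [rect]

theorem rect_subset {p r : ℕ × ℕ} (h₁ : p.1 ≤ r.1) (h₂ : p.2 ≤ r.2) : rect p ⊆ rect r :=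
  Finset.product_subset_product (Finset.range_mono h₁) (Finset.range_mono h₂)

/-- If the truncated centred sum is small, few terms are large and many terms are bounded away from
zero, then the sum is controlled by the Euclidean norm. -/
theorem abs_sum_le_of_cutoff {ι : Type*} {x m : ι → ℝ} {r s u : Finset ι} (hrs : r ⊆ s)
    (hsu : s ⊆ u) {B L v C K d c : ℝ} (hB : 0 < B) (hL : 0 < L) (hv : 0 ≤ v) (hC : 0 ≤ C)
    (hd : 0 < d) (hc : 0 < c) (hs : (s.card : ℝ) ≤ 4 * B ^ 2 * L) (hm : ∀ i, |m i| ≤ v / B)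
    (h₁ : |∑ i ∈ s, (cutoff B (x i) - m i)| ≤ C * B * L)
    (h₂ : ∑ i ∈ u, exceed B (x i) ≤ K * L)
    (h₃ : c * (B ^ 2 * L) ≤ ∑ i ∈ r, exceed d (x i)) :
    0 < ∑ i ∈ s, x i ^ 2 ∧
      |∑ i ∈ s, x i| ≤ ((C + 4 * v) / √(d ^ 2 * c) + √K) * √L * √(∑ i ∈ s, x i ^ 2) := by
  set V := ∑ i ∈ s, x i ^ 2 with hV
  have hVlow : d ^ 2 * c * (B ^ 2 * L) ≤ V := by
    calc d ^ 2 * c * (B ^ 2 * L) = d ^ 2 * (c * (B ^ 2 * L)) := by ring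
      _ ≤ d ^ 2 * ∑ i ∈ r, exceed d (x i) := by gcongr
      _ ≤ d ^ 2 * ∑ i ∈ s, exceed d (x i) := by
          gcongr
          exact fun i _ _ => exceed_nonneg _ _
      _ ≤ V := by
          rw [Finset.mul_sum]
          refine Finset.sum_le_sum fun i _ => ?_
          have := exceed_le_sq_div hd (x i)
          rw [le_div_iff₀ (by positivity)] at this
          linarith
  have hVpos : 0 < V := lt_of_lt_of_le (by positivity) hVlow
  refine ⟨hVpos, ?_⟩
  -- `BL = √L √(B²L)`, and `B²L` is bounded by a multiple of `V` through `hVlow`.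
  have hBL : B * L ≤ √L * √V / √(d ^ 2 * c) := by
    rw [le_div_iff₀ (by positivity)]
    have e : B * L * √(d ^ 2 * c) = √L * √(d ^ 2 * c * (B ^ 2 * L)) := by
      rw [Real.sqrt_mul (by positivity) (B ^ 2 * L), Real.sqrt_mul (by positivity) L,
        Real.sqrt_sq hB.le]
      calc B * L * √(d ^ 2 * c) = B * (√L * √L) * √(d ^ 2 * c) := by rw [Real.mul_self_sqrt hL.le]
        _ = _ := by ring
    rw [e]
    gcongr
  have hmean : |∑ i ∈ s, m i| ≤ 4 * v * (B * L) := by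
    calc |∑ i ∈ s, m i| ≤ ∑ i ∈ s, |m i| := Finset.abs_sum_le_sum_abs _ _
      _ ≤ ∑ _i ∈ s, v / B := Finset.sum_le_sum fun i _ => hm i
      _ = s.card * (v / B) := by simp
      _ ≤ 4 * B ^ 2 * L * (v / B) := by gcongr
      _ = 4 * v * (B * L) := by field_simp
  -- Cauchy–Schwarz against the indicators: the number of large terms enters only under a square
  -- root, and their size is absorbed by `V`.
  have hlarge : |∑ i ∈ s, exceed B (x i) * x i| ≤ √K * √L * √V := by
    have hsum : ∑ i ∈ s, exceed B (x i) ≤ K * L :=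
      (Finset.sum_le_sum_of_subset_of_nonneg hsu fun i _ _ => exceed_nonneg _ _).trans h₂
    have hK : 0 ≤ K := by
      have : 0 ≤ K * L := (Finset.sum_nonneg fun i _ => exceed_nonneg _ _).trans hsum
      exact nonneg_of_mul_nonneg_left this hL
    have := Finset.sum_mul_sq_le_sq_mul_sq s (fun i => exceed B (x i)) x
    simp only [exceed_sq] at this
    rw [← Real.sqrt_mul hK, ← Real.sqrt_mul (by positivity)]
    refine Real.abs_le_sqrt (this.trans ?_)
    gcongr
  have hsplit : ∑ i ∈ s, x i = ∑ i ∈ s, (cutoff B (x i) - m i) + ∑ i ∈ s, m i +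
      ∑ i ∈ s, exceed B (x i) * x i := by
    rw [← Finset.sum_add_distrib, ← Finset.sum_add_distrib]
    exact Finset.sum_congr rfl fun i _ => by linarith [cutoff_add_exceed_mul B (x i)]
  calc |∑ i ∈ s, x i| ≤ C * B * L + 4 * v * (B * L) + √K * √L * √V := by
        rw [hsplit]
        exact (abs_add_three _ _ _).trans (by gcongr)
    _ = (C + 4 * v) * (B * L) + √K * √L * √V := by ring
    _ ≤ (C + 4 * v) * (√L * √V / √(d ^ 2 * c)) + √K * √L * √V := by gcongr
    _ = _ := by ring

/-! ### Dyadic blocks -/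

/-- The logarithmic scale `log (a + b + 2)` of the dyadic block `(a, b)`. -/
noncomputable def blockLog (ab : ℕ × ℕ) : ℝ := Real.log (ab.1 + ab.2 + 2)

/-- The truncation level of the dyadic block `(a, b)`. -/
noncomputable def blockLevel (ab : ℕ × ℕ) : ℝ := √(2 ^ (ab.1 + ab.2) / blockLog ab)

theorem log_two_le_blockLog (ab : ℕ × ℕ) : Real.log 2 ≤ blockLog ab :=
  Real.log_le_log (by norm_num) (by
    have : (0 : ℝ) ≤ ab.1 + ab.2 := by positivity
    linarith)

theorem blockLog_pos (ab : ℕ × ℕ) : 0 < blockLog ab :=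
  (Real.log_pos one_lt_two).trans_le (log_two_le_blockLog ab)

theorem blockLevel_pos (ab : ℕ × ℕ) : 0 < blockLevel ab :=
  Real.sqrt_pos.2 (div_pos (by positivity) (blockLog_pos ab))

/-- The defining balance of the level: rectangles of the block have at most `4 * 2 ^ (a + b)` cells,
which is the size bound `4 * B ^ 2 * L` of the tail estimates. -/
theorem blockLevel_sq_mul (ab : ℕ × ℕ) :
    blockLevel ab ^ 2 * blockLog ab = 2 ^ (ab.1 + ab.2) := by
  unfold blockLevel
  have := blockLog_pos ab
  rw [Real.sq_sqrt (by positivity)]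
  field_simp

/-- The exponent `4` leaves two powers of `a + b + 2` for each index, enough to sum over both. -/
theorem exp_neg_blockLog_le (ab : ℕ × ℕ) :
    Real.exp (-4 * blockLog ab) ≤
      1 / ((ab.1 : ℝ) + 1) ^ 2 * (1 / ((ab.2 : ℝ) + 1) ^ 2) := by
  have hpos : (0 : ℝ) < ab.1 + ab.2 + 2 := by positivity
  have e : Real.exp (-4 * blockLog ab) = 1 / ((ab.1 : ℝ) + ab.2 + 2) ^ 4 := by
    rw [blockLog, neg_mul, Real.exp_neg, ← Real.exp_log (pow_pos hpos 4), Real.log_pow]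
    simp
  rw [e, one_div_mul_one_div]
  refine one_div_le_one_div_of_le (by positivity) ?_
  calc ((ab.1 : ℝ) + 1) ^ 2 * ((ab.2 : ℝ) + 1) ^ 2
      ≤ ((ab.1 : ℝ) + ab.2 + 2) ^ 2 * ((ab.1 : ℝ) + ab.2 + 2) ^ 2 := by
        have h1 : (0 : ℝ) ≤ ab.1 := by positivity
        have h2 : (0 : ℝ) ≤ ab.2 := by positivity
        gcongr <;> linarith
    _ = _ := by ring

theorem summable_blocks (A q : ℝ) : Summable fun ab : ℕ × ℕ =>
    A * (1 / ((ab.1 : ℝ) + 1) ^ 2 * (1 / ((ab.2 : ℝ) + 1) ^ 2)) +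
      q * ((1 / 2) ^ ab.1 * (1 / 2) ^ ab.2) := by
  have h1 : Summable fun n : ℕ => 1 / ((n : ℝ) + 1) ^ 2 := by
    have := (summable_nat_add_iff 1).2 (Real.summable_one_div_nat_pow.2 one_lt_two)
    simpa using this
  have h2 : Summable fun n : ℕ => (1 / 2 : ℝ) ^ n := summable_geometric_two
  exact ((h1.mul_of_nonneg h1 (fun n => by positivity) (fun n => by positivity)).mul_left A).add
    ((h2.mul_of_nonneg h2 (fun n => by positivity) (fun n => by positivity)).mul_left q)

/-- The dyadic block containing a pair of sizes. -/
def dyadicBlock (p : ℕ × ℕ) : ℕ × ℕ := (Nat.log 2 p.1, Nat.log 2 p.2)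

theorem mul_lt_two_pow_dyadicBlock (p : ℕ × ℕ) :
    p.1 * p.2 < 2 ^ ((dyadicBlock p).1 + (dyadicBlock p).2 + 2) := by
  have h1 := Nat.lt_pow_succ_log_self one_lt_two p.1
  have h2 := Nat.lt_pow_succ_log_self one_lt_two p.2
  calc p.1 * p.2 < 2 ^ (Nat.log 2 p.1 + 1) * 2 ^ (Nat.log 2 p.2 + 1) :=
        Nat.mul_lt_mul'' h1 h2
    _ = _ := by rw [← pow_add]; congr 1; simp only [dyadicBlock]; omega

theorem eventually_sizeAtTop (n : ℕ) : ∀ᶠ p in sizeAtTop, n ≤ p.1 * p.2 :=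
  tendsto_comap.eventually (eventually_ge_atTop n)

/-- The product `p₁p₂` is bounded on each block, so every block is eventually left; neither side
length need tend to infinity by itself. -/
theorem tendsto_dyadicBlock : Tendsto dyadicBlock sizeAtTop cofinite := by
  refine le_cofinite_iff_eventually_ne.2 fun ab => ?_
  change ∀ᶠ p in sizeAtTop, dyadicBlock p ≠ ab
  filter_upwards [eventually_sizeAtTop (2 ^ (ab.1 + ab.2 + 2))] with p hp h
  have := mul_lt_two_pow_dyadicBlock p
  rw [h] at this
  omega

/-- With `k = a + b`, `log (p₁p₂) ≥ k log 2`, and `k + 2 ≤ (k log 2)²` once `k ≥ 5`, which the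
threshold `64` guarantees. The square gives the factor `2`. -/
theorem blockLog_le_two_mul_log_log {p : ℕ × ℕ} (hp : 64 ≤ p.1 * p.2) :
    blockLog (dyadicBlock p) ≤ 2 * Real.log (Real.log ((p.1 : ℝ) * p.2)) := by
  have hp1 : p.1 ≠ 0 := fun h => by simp [h] at hp
  have hp2 : p.2 ≠ 0 := fun h => by simp [h] at hp
  set k := (dyadicBlock p).1 + (dyadicBlock p).2 with hk
  have hk5 : 5 ≤ k := by
    have := mul_lt_two_pow_dyadicBlock p
    rw [← hk] at this
    by_contra hcon
    have h6 : 2 ^ (k + 2) ≤ 2 ^ 6 := Nat.pow_le_pow_right two_pos (by omega)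
    omega
  have hlow : (2 : ℝ) ^ k ≤ (p.1 : ℝ) * p.2 := by
    have : 2 ^ k ≤ p.1 * p.2 := by
      rw [hk, pow_add]
      exact Nat.mul_le_mul (Nat.pow_log_le_self 2 hp1) (Nat.pow_log_le_self 2 hp2)
    exact_mod_cast this
  have hk5' : (5 : ℝ) ≤ k := by exact_mod_cast hk5
  have hlog : (k : ℝ) * Real.log 2 ≤ Real.log ((p.1 : ℝ) * p.2) := by
    rw [← Real.log_pow]
    exact Real.log_le_log (by positivity) hlow
  have hl2 := Real.log_two_gt_d9
  have hk2 : (0 : ℝ) < k * Real.log 2 := by positivity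
  calc blockLog (dyadicBlock p) = Real.log (k + 2) := by simp [blockLog, hk]
    _ ≤ Real.log ((k * Real.log 2) ^ 2) := by
        refine Real.log_le_log (by positivity) ?_
        have h3 : (k : ℝ) * 0.69 ≤ k * Real.log 2 := by gcongr; linarith
        nlinarith
    _ = 2 * Real.log (k * Real.log 2) := by rw [Real.log_pow]; norm_num
    _ ≤ _ := by gcongr

/-! ### Borel–Cantelli over the blocks -/

section

variable {Ω : Type*} [MeasurableSpace Ω] {μ : Measure Ω} [IsProbabilityMeasure μ]

/-- The exceptional event of the dyadic block `(a, b)`. -/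
def badEvent (μ : Measure Ω) (X : ℕ × ℕ → Ω → ℝ) (v d q : ℝ) (ab : ℕ × ℕ) : Set Ω :=
  {ω | ∃ m ≤ 2 ^ (ab.1 + 1), ∃ n ≤ 2 ^ (ab.2 + 1),
      9 * ((2 * v + 8) * blockLevel ab * blockLog ab) ≤
        |∑ i ∈ Finset.range m ×ˢ Finset.range n, (cutoff (blockLevel ab) (X i ω) -
          ∫ ω, cutoff (blockLevel ab) (X i ω) ∂μ)|} ∪
    ({ω | (8 * v + 4) * blockLog ab ≤
        ∑ i ∈ rect (2 ^ (ab.1 + 1), 2 ^ (ab.2 + 1)), exceed (blockLevel ab) (X i ω)} ∪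
      {ω | ∑ i ∈ rect (2 ^ ab.1, 2 ^ ab.2), exceed d (X i ω) ≤
        (rect (2 ^ ab.1, 2 ^ ab.2)).card * (q / 4)})

/-- The constants `2v + 8` and `8v + 4` in `badEvent` make both Chernoff exponents equal to `-4L`.
Then `19 = 9 * 2 + 1`: Etemadi's factor times two tails, plus the count of large entries. The last
term is `exp (-y) ≤ 1 / y`. -/
theorem measure_badEvent_le {X : ℕ × ℕ → Ω → ℝ} (hX : iIndepFun X μ)
    (hm : ∀ i, Measurable (X i)) (hint : ∀ i, Integrable (fun ω => X i ω ^ 2) μ) {v : ℝ}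
    (hv : ∀ i, ∫ ω, X i ω ^ 2 ∂μ ≤ v) (hv0 : 0 ≤ v) {d q : ℝ} (hq0 : 0 < q)
    (hq : ∀ i, q ≤ ∫ ω, exceed d (X i ω) ∂μ) (ab : ℕ × ℕ) :
    μ (badEvent μ X v d q ab) ≤ ENNReal.ofReal
      (19 * (1 / ((ab.1 : ℝ) + 1) ^ 2 * (1 / ((ab.2 : ℝ) + 1) ^ 2)) +
        4 / q * ((1 / 2) ^ ab.1 * (1 / 2) ^ ab.2)) := by
  set L := blockLog ab
  set B := blockLevel ab
  have hL : 0 < L := blockLog_pos ab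
  have hB : 0 < B := blockLevel_pos ab
  have hcard : ∀ m ≤ 2 ^ (ab.1 + 1), ∀ n ≤ 2 ^ (ab.2 + 1),
      ((Finset.range m ×ˢ Finset.range n).card : ℝ) ≤ 4 * B ^ 2 * L := by
    intro m hm n hn
    rw [mul_assoc, blockLevel_sq_mul]
    have : (Finset.range m ×ˢ Finset.range n).card ≤ 4 * 2 ^ (ab.1 + ab.2) := by
      rw [Finset.card_product, Finset.card_range, Finset.card_range]
      calc m * n ≤ 2 ^ (ab.1 + 1) * 2 ^ (ab.2 + 1) := Nat.mul_le_mul hm hn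
        _ = _ := by ring
    exact_mod_cast this
  have h1 := etemadi_maximal_inequality_rectangles (μ := μ)
    (Y := fun i ω => cutoff B (X i ω) - ∫ ω, cutoff B (X i ω) ∂μ)
    (hX.comp (fun i x => cutoff B x - ∫ ω, cutoff B (X i ω) ∂μ)
      fun i => (measurable_cutoff B).sub_const _)
    (fun i => ((measurable_cutoff B).comp (hm i)).sub_const _)
    (2 ^ (ab.1 + 1)) (2 ^ (ab.2 + 1)) (t := (2 * v + 8) * B * L) (by positivity) _
    (fun m hm' n hn' => measure_abs_sum_cutoff_ge hX hm hint hv hB hv0 _ (hcard m hm' n hn'))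
  have h2 := measure_sum_exceed_ge hX hm hint hv (K := 8 * v + 4) hB hv0
    (rect (2 ^ (ab.1 + 1), 2 ^ (ab.2 + 1))) (hcard _ le_rfl _ le_rfl)
  have h3 := measure_sum_exceed_le hX hm hq (rect (2 ^ ab.1, 2 ^ ab.2))
  have e1 : (v - (2 * v + 8) / 2) * L = -4 * L := by ring
  have e2 : (8 * v - (8 * v + 4)) * L = -4 * L := by ring
  rw [e1] at h1
  rw [e2] at h2
  have h4 : Real.exp (-((rect (2 ^ ab.1, 2 ^ ab.2)).card * (q / 4))) ≤
      4 / q * ((1 / 2) ^ ab.1 * (1 / 2) ^ ab.2) := by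
    rw [card_rect]
    push_cast
    set y : ℝ := 2 ^ ab.1 * 2 ^ ab.2 * (q / 4) with hy
    have hy0 : 0 < y := by positivity
    have e : 4 / q * ((1 / 2) ^ ab.1 * (1 / 2) ^ ab.2) = 1 / y := by
      rw [hy, one_div_pow, one_div_pow]; field_simp
    rw [e, Real.exp_neg, ← one_div]
    exact one_div_le_one_div_of_le hy0 (by linarith [Real.add_one_le_exp y])
  have h5 := exp_neg_blockLog_le ab
  calc μ (badEvent μ X v d q ab) ≤ 9 * (2 * ENNReal.ofReal (Real.exp (-4 * L))) +
        (ENNReal.ofReal (Real.exp (-4 * L)) + ENNReal.ofReal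
          (Real.exp (-((rect (2 ^ ab.1, 2 ^ ab.2)).card * (q / 4))))) :=
        (measure_union_le _ _).trans (add_le_add h1 ((measure_union_le _ _).trans
          (add_le_add h2 h3)))
    _ = ENNReal.ofReal (19 * Real.exp (-4 * L) +
          Real.exp (-((rect (2 ^ ab.1, 2 ^ ab.2)).card * (q / 4)))) := by
        rw [ENNReal.ofReal_add (by positivity) (by positivity),
          ENNReal.ofReal_mul (by norm_num), ENNReal.ofReal_ofNat]
        ring
    _ ≤ _ := ENNReal.ofReal_le_ofReal (by gcongr)

/-- The self-normalized law of the iterated logarithm (upper bound) over all rectangles. -/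
theorem ae_eventually_abs_sum_rect_le {X : ℕ × ℕ → Ω → ℝ} (hX : iIndepFun X μ)
    (hm : ∀ i, Measurable (X i)) (hint : ∀ i, MemLp (X i) 2 μ) (h0 : ∀ i, ∫ ω, X i ω ∂μ = 0)
    {v : ℝ} (hv : ∀ i, ∫ ω, X i ω ^ 2 ∂μ ≤ v) (hv0 : 0 ≤ v) {d q : ℝ} (hd : 0 < d) (hq0 : 0 < q)
    (hq : ∀ i, q ≤ ∫ ω, exceed d (X i ω) ∂μ) :
    ∃ M, 0 ≤ M ∧ ∀ᵐ ω ∂μ, ∀ᶠ p in sizeAtTop, 0 < ∑ i ∈ rect p, X i ω ^ 2 ∧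
      |∑ i ∈ rect p, X i ω| ≤
        M * √(blockLog (dyadicBlock p)) * √(∑ i ∈ rect p, X i ω ^ 2) := by
  refine ⟨(9 * (2 * v + 8) + 4 * v) / √(d ^ 2 * (q / 4)) + √(8 * v + 4), by positivity, ?_⟩
  have hsum : ∑' ab, μ (badEvent μ X v d q ab) ≠ ⊤ :=
    ne_top_of_le_ne_top (summable_blocks 19 (4 / q)).tsum_ofReal_ne_top
      (ENNReal.tsum_le_tsum fun ab =>
        measure_badEvent_le hX hm (fun i => (hint i).integrable_sq) hv hv0 hq0 hq ab)
  filter_upwards [ae_finite_setOfPred_mem hsum] with ω hω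
  have hgood : ∀ᶠ p in sizeAtTop, ω ∉ badEvent μ X v d q (dyadicBlock p) :=
    tendsto_dyadicBlock.eventually hω.eventually_cofinite_notMem
  -- Both sides must be nonzero: `Nat.log 2 0 = 0`, so an empty side would not contain the lower
  -- corner of its block.
  filter_upwards [hgood, eventually_sizeAtTop 1] with p hp hp1
  have hp1' : p.1 ≠ 0 := fun h => by simp [h] at hp1
  have hp2' : p.2 ≠ 0 := fun h => by simp [h] at hp1
  set ab := dyadicBlock p with hab
  have hup1 : p.1 ≤ 2 ^ (ab.1 + 1) := (Nat.lt_pow_succ_log_self one_lt_two p.1).le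
  have hup2 : p.2 ≤ 2 ^ (ab.2 + 1) := (Nat.lt_pow_succ_log_self one_lt_two p.2).le
  simp only [badEvent, Set.mem_union, Set.mem_ofPred_eq, not_or, not_exists, not_and, not_le] at hp
  obtain ⟨g1, g2, g3⟩ := hp
  refine abs_sum_le_of_cutoff (r := rect (2 ^ ab.1, 2 ^ ab.2))
    (u := rect (2 ^ (ab.1 + 1), 2 ^ (ab.2 + 1))) (x := fun i => X i ω)
    (m := fun i => ∫ ω, cutoff (blockLevel ab) (X i ω) ∂μ) (B := blockLevel ab)
    (rect_subset (Nat.pow_log_le_self 2 hp1') (Nat.pow_log_le_self 2 hp2'))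
    (rect_subset hup1 hup2) (blockLevel_pos ab) (blockLog_pos ab) hv0 (by positivity) hd
    (by positivity) ?_ (fun i => ?_) ?_ g2.le ?_
  · rw [mul_assoc, blockLevel_sq_mul, card_rect]
    have : p.1 * p.2 ≤ 4 * 2 ^ (ab.1 + ab.2) :=
      (mul_lt_two_pow_dyadicBlock p).le.trans (by rw [← hab]; ring_nf; exact le_rfl)
    exact_mod_cast this
  · exact abs_integral_cutoff_le (hm i) ((hint i).integrable one_le_two) (hint i).integrable_sq
      (h0 i) (hv i) (blockLevel_pos ab)
  · have := (g1 p.1 hup1 p.2 hup2).le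
    rw [← mul_assoc, ← mul_assoc] at this
    exact this
  · refine le_trans (le_of_eq ?_) g3.le
    rw [blockLevel_sq_mul, card_rect]
    push_cast
    ring

end

/-! ### From sums to the Hoyer index -/

theorem sum_fin_eq_sum_rect (p : ℕ × ℕ) (f : ℕ → ℕ → ℝ) :
    ∑ i : Fin p.1, ∑ j : Fin p.2, f i j = ∑ x ∈ rect p, f x.1 x.2 := by
  rw [rect, Finset.sum_product, Finset.sum_range]
  exact Finset.sum_congr rfl fun i _ => (Finset.sum_range _).symm

theorem hoyerIndex_noiseMatrix {Ω : Type*} (e : ℕ → ℕ → Ω → ℝ) (p : ℕ × ℕ) (ω : Ω) :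
    hoyerIndex (noiseMatrix e p.1 p.2 ω) =
      (√((p.1 : ℝ) * p.2) - |∑ x ∈ rect p, e x.1 x.2 ω| / √(∑ x ∈ rect p, e x.1 x.2 ω ^ 2)) *
        (√((p.1 : ℝ) * p.2) - 1)⁻¹ := by
  rw [hoyerIndex, Matrix.frobenius_norm_def, ← Real.sqrt_eq_rpow]
  simp only [noiseMatrix, Matrix.of_apply, Real.norm_eq_abs, Real.rpow_ofNat, sq_abs]
  rw [sum_fin_eq_sum_rect p fun i j => e i j ω, sum_fin_eq_sum_rect p fun i j => e i j ω ^ 2]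

/-- A variable with positive second moment is bounded away from zero with positive probability. -/
theorem exists_integral_exceed_pos {Ω : Type*} [MeasurableSpace Ω] {μ : Measure Ω}
    [IsProbabilityMeasure μ] {W : Ω → ℝ} (hW : AEMeasurable W μ) (h : 0 < ∫ ω, W ω ^ 2 ∂μ) :
    ∃ d, 0 < d ∧ 0 < ∫ ω, exceed d (W ω) ∂μ := by
  by_contra! hcon
  -- Otherwise `|W| ≤ 1 / (n + 1)` almost surely for every `n`, which forces `W = 0` and contradicts
  -- the second moment.
  have key : ∀ n : ℕ, ∀ᵐ ω ∂μ, |W ω| ≤ 1 / ((n : ℝ) + 1) := fun n => by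
    have hi : Integrable (fun ω => exceed (1 / ((n : ℝ) + 1)) (W ω)) μ :=
      Integrable.of_bound ((measurable_exceed _).comp_aemeasurable hW).aestronglyMeasurable 1
        (ae_of_all _ fun ω => abs_exceed_le _ _)
    have h0 := le_antisymm (hcon (1 / ((n : ℝ) + 1)) (by positivity))
      (integral_nonneg fun ω => exceed_nonneg _ _)
    rw [integral_eq_zero_iff_of_nonneg (fun ω => exceed_nonneg _ _) hi] at h0
    filter_upwards [h0] with ω hω
    by_contra hlt
    simp [exceed] at hω
    exact hlt (by simpa using hω)
  have hzero : ∀ᵐ ω ∂μ, W ω ^ 2 = 0 := by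
    filter_upwards [ae_all_iff.2 key] with ω hω
    have := ge_of_tendsto' (tendsto_one_div_add_atTop_nhds_zero_nat (𝕜 := ℝ)) hω
    simp [abs_nonpos_iff.1 this]
  rw [integral_congr_ae hzero] at h
  simp at h

/-- The deterministic estimate that turns a self-normalized bound for the sum of the entries into a
bound for the Hoyer index. -/
theorem abs_one_sub_le_of_ratio_le {n r M L l : ℝ} (hn : 4 ≤ n) (hr0 : 0 ≤ r) (hM : 0 ≤ M)
    (hL : Real.log 2 ≤ L) (hLl : L ≤ 2 * l) (hr : r ≤ M * √L) :
    |1 - (√n - r) * (√n - 1)⁻¹| ≤ 4 * (M + 2) * |√(l / n)| := by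
  have hn2 : 2 ≤ √n := Real.le_sqrt_of_sq_le (by norm_num; exact hn)
  have hl2 := Real.log_two_gt_d9
  have hl0 : 0 ≤ l := by linarith
  -- The lower bound on `L` lets `2√L` absorb the constant `1` in `|r - 1|`.
  have hsL : 1 / 2 ≤ √L := Real.le_sqrt_of_sq_le (by norm_num; linarith)
  have hsl : √L ≤ 2 * √l := by
    rw [Real.sqrt_le_left (by positivity), mul_pow, Real.sq_sqrt hl0]
    linarith
  have e : 1 - (√n - r) * (√n - 1)⁻¹ = (r - 1) / (√n - 1) := by
    have : √n - 1 ≠ 0 := by linarith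
    field_simp
    ring
  rw [e, abs_div, abs_of_pos (by linarith : 0 < √n - 1), Real.sqrt_div hl0,
    abs_of_nonneg (by positivity : 0 ≤ √l / √n)]
  calc |r - 1| / (√n - 1) ≤ ((M + 2) * √L) / (√n / 2) := by
        gcongr
        · exact abs_le.2 ⟨by nlinarith [mul_nonneg hM (Real.sqrt_nonneg L)], by linarith⟩
        · linarith
    _ ≤ ((M + 2) * (2 * √l)) / (√n / 2) := by gcongr
    _ = _ := by field_simp; ring

theorem mainTheorem3 {Ω : Type*} [MeasurableSpace Ω] (μ : Measure Ω) [IsProbabilityMeasure μ]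
    (e : ℕ → ℕ → Ω → ℝ) (σ : ℝ) (hσ : 0 < σ)
    (hindep : iIndepFun (fun (p : ℕ × ℕ) => e p.1 p.2) μ)
    (hident : ∀ i j, IdentDistrib (e i j) (e 0 0) μ μ)
    (hL2 : ∀ i j, MemLp (e i j) 2 μ)
    (hmean : ∀ i j, ∫ ω, e i j ω ∂μ = 0)
    (hvar : ∀ i j, variance (e i j) μ = σ ^ 2) :
    (∀ᵐ ω ∂μ, ∀ᶠ p in sizeAtTop, noiseMatrix e p.1 p.2 ω ≠ 0) ∧
    IsBigOAS μ sizeAtTop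
      (fun p ω => 1 - hoyerIndex (noiseMatrix e p.1 p.2 ω))
      (fun p => √(Real.log (Real.log ((p.1 : ℝ) * p.2)) / ((p.1 : ℝ) * p.2))) := by
  have hae : ∀ i j, AEMeasurable (e i j) μ := fun i j => (hident i j).aemeasurable_fst
  have hsq : ∀ i j, ∫ ω, e i j ω ^ 2 ∂μ = σ ^ 2 := fun i j => by
    rw [← hvar i j, variance_of_integral_eq_zero (hae i j) (hmean i j)]
  obtain ⟨d, hd, hq⟩ := exists_integral_exceed_pos (hae 0 0) (by rw [hsq]; positivity)
  -- The entries are only almost everywhere measurable; there are countably many, so measurable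
  -- versions agree with all of them at once almost surely.
  let X : ℕ × ℕ → Ω → ℝ := fun x => (hae x.1 x.2).mk
  have hXe : ∀ x : ℕ × ℕ, e x.1 x.2 =ᵐ[μ] X x := fun x => (hae x.1 x.2).ae_eq_mk
  obtain ⟨M, hM, hbound⟩ := ae_eventually_abs_sum_rect_le (μ := μ) (X := X) (v := σ ^ 2)
    (hindep.congr hXe)
    (fun x => (hae x.1 x.2).measurable_mk) (fun x => (memLp_congr_ae (hXe x)).1 (hL2 _ _))
    (fun x => by rw [← integral_congr_ae (hXe x), hmean])
    (fun x => by
      rw [← hsq x.1 x.2]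
      exact (integral_congr_ae ((hXe x).symm.fun_comp (· ^ 2))).le)
    (sq_nonneg σ) hd hq (fun x => by
      exact (((hident x.1 x.2).comp (measurable_exceed d)).integral_eq.symm.trans
        (integral_congr_ae ((hXe x).fun_comp (exceed d)))).le)
  have hfinal : ∀ᵐ ω ∂μ, ∀ᶠ p in sizeAtTop, 0 < ∑ x ∈ rect p, e x.1 x.2 ω ^ 2 ∧
      |∑ x ∈ rect p, e x.1 x.2 ω| ≤
        M * √(blockLog (dyadicBlock p)) * √(∑ x ∈ rect p, e x.1 x.2 ω ^ 2) := by
    filter_upwards [hbound, ae_all_iff.2 hXe] with ω hω hω'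
    simpa only [hω'] using hω
  refine ⟨?_, ?_⟩
  · filter_upwards [hfinal] with ω hω
    filter_upwards [hω] with p hp hzero
    refine hp.1.ne' ?_
    rw [← sum_fin_eq_sum_rect p fun i j => e i j ω ^ 2]
    refine Finset.sum_eq_zero fun i _ => Finset.sum_eq_zero fun j _ => ?_
    have : e i j ω = 0 := congrFun (congrFun hzero i) j
    simp [this]
  · filter_upwards [hfinal] with ω hω
    refine IsBigO.of_bound (4 * (M + 2)) ?_
    filter_upwards [hω, eventually_sizeAtTop 64] with p hp hp64
    rw [hoyerIndex_noiseMatrix]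
    have h64 : (64 : ℝ) ≤ (p.1 : ℝ) * p.2 := by exact_mod_cast hp64
    exact abs_one_sub_le_of_ratio_le (by linarith) (by positivity) hM (log_two_le_blockLog _)
      (blockLog_le_two_mul_log_log hp64) ((div_le_iff₀ (Real.sqrt_pos.2 hp.1)).2 hp.2)
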